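/- **Theorem.** Fix $\alpha\in(0,1)$. Put $\sigma=\sqrt{\alpha(1-\alpha)}$ and $\sigma_t=\sigma/\sqrt t$ for $t>0$. Let $W$ be a standard two-dimensional Brownian motion started at $0$, let $|\cdot|$ be the Euclidean norm on $\mathbb R^2$, and let the scaled Conga line at time $t$ be $$u_t(x)=\int_0^1 W(1-s)\,\frac{1}{\sqrt{2\pi}}\,\frac{x+\alpha s}{2\sigma_t s^{3/2}}\exp\left(-\frac{(x-\alpha s)^2}{2\sigma_t^2 s}\right)ds ,\qquad 0<x\le\alpha .$$ For $M>0$ let $L_t^x=\alpha^{-1}\sqrt{-M\sigma_t^2x\log(\sigma_t^2x)}$, and call $x\in(0,\alpha]$ *admissible* at time $t$ if $x>\alpha L_t^x$. There is a deterministic constant $\kappa>0$, depending only on $\alpha$, such that the following hold. 1. For every $M>0$, almost surely there is a (random) $T>0$ such that for all $t\ge T$ and all $x\in(0,\alpha]$ admissible at time $t$, $$\left|u_t(x)-W\left(1-\tfrac{x}{\alpha}\right)\right|\le\kappa\sqrt{-\left(\tfrac{x}{t}\right)^{1/2}\log\left(\tfrac{x}{t}\right)} .$$ 2. In particular, for every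 $\beta\in(0,1)$, almost surely there is $T>0$ such that the bound in 1 holds for all $t\ge T$ and all $x\in[t^{-\beta},\alpha]$. 3. For every $\beta\in(0,1)$ there is a deterministic $t_0$, depending only on $\alpha$ and $\beta$, such that for all $t\ge t_0$ $$\mathbb P\left(\left|u_t(x)-W\left(1-\tfrac{x}{\alpha}\right)\right|>\kappa\sqrt{-\left(\tfrac{x}{t}\right)^{1/2}\log\left(\tfrac{x}{t}\right)}\ \text{ for some } x\in[t^{-\beta},\alpha]\right)\le t^{-2}.$$ 4. Consequently, for every $M>0$, almost surely there is $T>0$ such that for all $t\ge T$ and all $x\in(0,\alpha]$ admissible at time $t$, $$\left|u_t(x)-W\left(1-\tfrac{x}{\alpha}\right)\right|\le\kappa\, t^{-1/4}\sqrt{\log t} .$$ -/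

import Mathlib

open MeasureTheory ProbabilityTheory
open scoped NNReal ENNReal

universe u

/-- A standard planar Brownian motion started at the origin: both coordinates are standard
one-dimensional Brownian motions (with almost surely continuous paths), and the two coordinate
processes are independent. -/
structure IsPlanarBrownian {Ω : Type u} [MeasurableSpace Ω]
    (W : ℝ≥0 → Ω → EuclideanSpace ℝ (Fin 2)) (P : Measure Ω) : Prop where
  coord : ∀ i : Fin 2, IsBrownianReal (fun t ω => W t ω i) P
  indep : IndepFun (fun ω (t : ℝ≥0) => W t ω 0) (fun ω (t : ℝ≥0) => W t ω 1) P

/-- The scaled diffusivity `σ_t = σ / √t`, where `σ = √(α (1 - α))`. -/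
noncomputable def congaSigma (α t : ℝ) : ℝ := √(α * (1 - α)) / √t

/-- The smoothing kernel
`(2π)^{-1/2} (x + α s) / (2 σ_t s^{3/2}) exp (-(x - α s)² / (2 σ_t² s))`. -/
noncomputable def congaKernel (α t x s : ℝ) : ℝ :=
  (√(2 * Real.pi))⁻¹ * ((x + α * s) / (2 * congaSigma α t * s ^ (3 / 2 : ℝ))) *
    Real.exp (-(x - α * s) ^ 2 / (2 * congaSigma α t ^ 2 * s))

/-- The scaled Conga line `u_t(x) = ∫₀¹ W(1 - s) k_t(x, s) ds` driven by the path `w`. -/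
noncomputable def scaledConga (α t : ℝ) (w : ℝ≥0 → EuclideanSpace ℝ (Fin 2)) (x : ℝ) :
    EuclideanSpace ℝ (Fin 2) :=
  ∫ s in (0 : ℝ)..1, congaKernel α t x s • w (Real.toNNReal (1 - s))

/-- The window width `L_t^x = α⁻¹ √(-M σ_t² x log (σ_t² x))`. -/
noncomputable def congaWindow (α M t x : ℝ) : ℝ :=
  α⁻¹ * √(-(M * (congaSigma α t ^ 2 * x) * Real.log (congaSigma α t ^ 2 * x)))

/-- The points `x ∈ (0, α]` that are not too close to the tip: `x > α L_t^x`. -/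
def congaAdmissible (α M t : ℝ) : Set ℝ :=
  {x | x ∈ Set.Ioc 0 α ∧ α * congaWindow α M t x < x}

/-- The distance `|u_t(x) - W(1 - x/α)|`, with the Euclidean norm of the plane. -/
noncomputable def congaError (α t : ℝ) (w : ℝ≥0 → EuclideanSpace ℝ (Fin 2)) (x : ℝ) : ℝ :=
  ‖scaledConga α t w x - w (Real.toNNReal (1 - x / α))‖

/-- The error scale `√(-(x/t)^{1/2} log (x/t))`. -/
noncomputable def congaRate (t x : ℝ) : ℝ :=
  √(-((x / t) ^ (1 / 2 : ℝ) * Real.log (x / t)))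

/-! In the score `(α s - x) / (σ_t √s)` the smoothing kernel becomes the standard Gaussian density.
Hence `u_t(x)` averages the path around time `1 - x/α` over a window whose mean width is of order
`√(x/t)`, and the error is governed by the oscillation of the path at that scale. Dyadic chaining
bounds this oscillation by Lévy's modulus `√(h log (t/h))`, simultaneously for all `h`, outside an
event of probability at most `t⁻²`. This event decreases in `t`, so almost every path avoids it
from some time on. -/

section DyadicChaining

/-- The largest multiple of `2⁻ⁿ` below `a`, for `a ≥ 0`. -/
noncomputable def dyadicFloor (n : ℕ) (a : ℝ) : ℝ := ⌊2 ^ n * a⌋₊ / 2 ^ n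

/-- The increments of `f` over the dyadic subintervals of `[0, 1]` of length `2⁻ⁿ` are at most
`D n`, at every level `n`. -/
def DyadicIncrementsLE {E : Type*} [PseudoMetricSpace E] (f : ℝ → E) (D : ℕ → ℝ) : Prop :=
  ∀ n j : ℕ, j < 2 ^ n → dist (f (j / 2 ^ n)) (f ((j + 1 : ℕ) / 2 ^ n)) ≤ D n

theorem floor_two_mul_eq_or {K : Type*} [Semifield K] [LinearOrder K] [IsStrictOrderedRing K]
    [FloorSemiring K] (y : K) : ⌊2 * y⌋₊ = 2 * ⌊y⌋₊ ∨ ⌊2 * y⌋₊ = 2 * ⌊y⌋₊ + 1 := by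
  have h := Nat.floor_div_ofNat (2 * y) 2
  rw [mul_div_cancel_left₀ y two_ne_zero] at h
  have : ⌊y⌋₊ = ⌊2 * y⌋₊ / 2 := h
  omega

theorem floor_two_pow_mul_le {a : ℝ} (ha : a ≤ 1) (n : ℕ) : ⌊2 ^ n * a⌋₊ ≤ 2 ^ n :=
  Nat.floor_le_of_le (by push_cast; exact mul_le_of_le_one_right (by positivity) ha)

theorem dyadicFloor_mem_Icc {a : ℝ} (ha : a ≤ 1) (n : ℕ) :
    dyadicFloor n a ∈ Set.Icc (0 : ℝ) 1 := by
  refine ⟨by unfold dyadicFloor; positivity, div_le_one_of_le₀ ?_ (by positivity)⟩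
  exact_mod_cast floor_two_pow_mul_le ha n

theorem tendsto_dyadicFloor {a : ℝ} (ha : 0 ≤ a) :
    Filter.Tendsto (fun n => dyadicFloor n a) Filter.atTop (nhds a) := by
  have hpow := tendsto_pow_atTop_atTop_of_one_lt (one_lt_two (α := ℝ))
  refine ((tendsto_nat_floor_mul_div_atTop ha).comp hpow).congr fun n => ?_
  simp only [dyadicFloor, Function.comp_apply, mul_comm a]

variable {E : Type*} [PseudoMetricSpace E] {f : ℝ → E} {D : ℕ → ℝ} {r a b : ℝ}

theorem DyadicIncrementsLE.nonneg (hf : DyadicIncrementsLE f D) (n : ℕ) : 0 ≤ D n :=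
  dist_nonneg.trans (hf n 0 (by positivity))

theorem DyadicIncrementsLE.dist_floor_le (hf : DyadicIncrementsLE f D) {n i j : ℕ}
    (hij : j = i ∨ j = i + 1) (hj : j ≤ 2 ^ n) : dist (f (i / 2 ^ n)) (f (j / 2 ^ n)) ≤ D n := by
  rcases hij with rfl | rfl
  · simpa using hf.nonneg n
  · exact hf n i hj

theorem DyadicIncrementsLE.dist_dyadicFloor_succ_le (hf : DyadicIncrementsLE f D) (ha : a ≤ 1)
    (n : ℕ) : dist (f (dyadicFloor n a)) (f (dyadicFloor (n + 1) a)) ≤ D (n + 1) := by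
  have hcoarse : dyadicFloor n a = (2 * ⌊2 ^ n * a⌋₊ : ℕ) / 2 ^ (n + 1) := by
    rw [dyadicFloor]; push_cast; field_simp; ring
  rw [hcoarse]
  refine hf.dist_floor_le ?_ (floor_two_pow_mul_le ha (n + 1))
  rw [pow_succ', mul_assoc]
  exact floor_two_mul_eq_or _

theorem DyadicIncrementsLE.dist_dyadicFloor_dyadicFloor_le (hf : DyadicIncrementsLE f D)
    (ha : 0 ≤ a) (hb : b ≤ 1) (hab : a ≤ b) {n : ℕ} (hn : (b - a) * 2 ^ n ≤ 1) :
    dist (f (dyadicFloor n a)) (f (dyadicFloor n b)) ≤ D n := by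
  have hle : ⌊2 ^ n * a⌋₊ ≤ ⌊2 ^ n * b⌋₊ := Nat.floor_le_floor (by gcongr)
  have hge : ⌊2 ^ n * b⌋₊ ≤ ⌊2 ^ n * a⌋₊ + 1 := by
    rw [← Nat.floor_add_one (by positivity)]
    exact Nat.floor_le_floor (by linarith)
  exact hf.dist_floor_le (by omega) (floor_two_pow_mul_le hb n)

theorem DyadicIncrementsLE.dist_dyadicFloor_le (hf : DyadicIncrementsLE f D)
    (hcont : ContinuousOn f (Set.Icc 0 1)) (hr : 0 ≤ r) (hr1 : r < 1)
    (hD : ∀ n, D (n + 1) ≤ r * D n) (ha : a ∈ Set.Icc (0 : ℝ) 1) (n : ℕ) :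
    dist (f (dyadicFloor n a)) (f a) ≤ r * D n / (1 - r) := by
  have hdecay (k : ℕ) : D (n + k) ≤ r ^ k * D n := by
    induction k with
    | zero => simp
    | succ k ih => calc
        D (n + (k + 1)) ≤ r * D (n + k) := hD (n + k)
        _ ≤ r * (r ^ k * D n) := by gcongr
        _ = r ^ (k + 1) * D n := by ring
  have hstep (k : ℕ) : dist (f (dyadicFloor (n + k) a)) (f (dyadicFloor (n + (k + 1)) a)) ≤
      r * D n * r ^ k :=
    (hf.dist_dyadicFloor_succ_le ha.2 (n + k)).trans ((hdecay (k + 1)).trans_eq (by ring))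
  have hlim : Filter.Tendsto (fun k => f (dyadicFloor (n + k) a)) Filter.atTop (nhds (f a)) := by
    refine (hcont a ha).tendsto.comp (tendsto_nhdsWithin_iff.2
      ⟨?_, Filter.Eventually.of_forall fun k => dyadicFloor_mem_Icc ha.2 (n + k)⟩)
    simp_rw [add_comm n]
    exact (Filter.tendsto_add_atTop_iff_nat n).2 (tendsto_dyadicFloor ha.1)
  exact dist_le_of_le_geometric_of_tendsto₀ r _ hr1 hstep hlim

theorem DyadicIncrementsLE.dist_le (hf : DyadicIncrementsLE f D)
    (hcont : ContinuousOn f (Set.Icc 0 1)) (hr : 0 ≤ r) (hr1 : r < 1)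
    (hD : ∀ n, D (n + 1) ≤ r * D n) (ha : a ∈ Set.Icc (0 : ℝ) 1) (hb : b ∈ Set.Icc (0 : ℝ) 1)
    {n : ℕ} (hn : dist a b * 2 ^ n ≤ 1) : dist (f a) (f b) ≤ (1 + r) / (1 - r) * D n := by
  wlog hab : a ≤ b generalizing a b
  · rw [dist_comm]
    exact this hb ha (by rwa [dist_comm]) (le_of_not_ge hab)
  rw [dist_comm, Real.dist_eq, abs_of_nonneg (sub_nonneg.2 hab)] at hn
  have hne : 1 - r ≠ 0 := by linarith
  calc dist (f a) (f b)
      ≤ dist (f a) (f (dyadicFloor n a)) + dist (f (dyadicFloor n a)) (f (dyadicFloor n b)) +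
          dist (f (dyadicFloor n b)) (f b) := dist_triangle4 _ _ _ _
    _ ≤ r * D n / (1 - r) + D n + r * D n / (1 - r) := by
        rw [dist_comm (f a)]
        gcongr
        · exact hf.dist_dyadicFloor_le hcont hr hr1 hD ha n
        · exact hf.dist_dyadicFloor_dyadicFloor_le ha.1 hb.2 hab hn
        · exact hf.dist_dyadicFloor_le hcont hr hr1 hD hb n
    _ = (1 + r) / (1 - r) * D n := by field_simp; ring

end DyadicChaining

section LevyModulus

/-- The shape of Lévy's modulus of continuity at the dyadic scale `2⁻ⁿ`; raising the level `ℓ`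
makes it exponentially unlikely that a Brownian increment exceeds a multiple of it. -/
noncomputable def levyBound (ℓ : ℝ) (n : ℕ) : ℝ := √((n + ℓ) / 2 ^ n)

theorem levyBound_succ_le {ℓ : ℝ} (hℓ : 2 ≤ ℓ) (n : ℕ) :
    levyBound ℓ (n + 1) ≤ 9 / 10 * levyBound ℓ n := by
  refine Real.sqrt_le_iff.2 ⟨by unfold levyBound; positivity, ?_⟩
  rw [levyBound, mul_pow, Real.sq_sqrt (by positivity), ← mul_div_assoc,
    div_le_div_iff₀ (by positivity) (by positivity), pow_succ' (2 : ℝ), Nat.cast_succ, ← mul_assoc]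
  gcongr
  linarith [n.cast_nonneg (α := ℝ)]

theorem levyBound_le {ℓ h : ℝ} (hℓ : 0 ≤ ℓ) {n : ℕ} (hn : 2 ^ n ≤ h⁻¹) (hn' : h⁻¹ < 2 ^ (n + 1)) :
    levyBound ℓ n ≤ √(2 * h * (2 * Real.log h⁻¹ + ℓ)) := by
  have hinv : 0 < h⁻¹ := (by positivity : (0 : ℝ) < 2 ^ n).trans_le hn
  have hh : 0 < h := inv_pos.1 hinv
  have hlog : (n : ℝ) ≤ 2 * Real.log h⁻¹ := by
    have hlog_pow := Real.log_le_log (by positivity) hn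
    rw [Real.log_pow] at hlog_pow
    nlinarith [Real.log_two_gt_d9, n.cast_nonneg (α := ℝ)]
  have hscale : (2 ^ n : ℝ)⁻¹ ≤ 2 * h := by
    rw [inv_le_comm₀ (by positivity) (by positivity), mul_inv]
    rw [pow_succ] at hn'
    linarith
  rw [levyBound, div_eq_inv_mul]
  gcongr

theorem dist_le_of_dyadicIncrementsLE_levyBound {E : Type*} [PseudoMetricSpace E] {f : ℝ → E}
    {A ℓ : ℝ} (hcont : ContinuousOn f (Set.Icc 0 1)) (hA : 0 ≤ A) (hℓ : 2 ≤ ℓ)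
    (hf : DyadicIncrementsLE f fun n => A * levyBound ℓ n) {a b : ℝ} (ha : a ∈ Set.Icc (0 : ℝ) 1)
    (hb : b ∈ Set.Icc (0 : ℝ) 1) :
    dist (f a) (f b) ≤ 19 * A * √(2 * dist a b * (2 * Real.log (dist a b)⁻¹ + ℓ)) := by
  rcases eq_or_ne a b with rfl | hne
  · simp
  have hpos : 0 < dist a b := dist_pos.2 hne
  have hone : dist a b ≤ 1 := by simpa using Real.dist_le_of_mem_Icc ha hb
  obtain ⟨n, hn, hn'⟩ := exists_nat_pow_near ((one_le_inv₀ hpos).2 hone) one_lt_two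
  have hdecay (n : ℕ) : A * levyBound ℓ (n + 1) ≤ 9 / 10 * (A * levyBound ℓ n) := by
    rw [mul_left_comm]
    exact mul_le_mul_of_nonneg_left (levyBound_succ_le hℓ n) hA
  have hscale : dist a b * 2 ^ n ≤ 1 := by rwa [mul_comm, ← le_div_iff₀ hpos, one_div]
  calc dist (f a) (f b) ≤ (1 + 9 / 10) / (1 - 9 / 10) * (A * levyBound ℓ n) :=
        hf.dist_le hcont (by norm_num) (by norm_num) hdecay ha hb hscale
    _ = 19 * A * levyBound ℓ n := by ring
    _ ≤ _ := by gcongr; exact levyBound_le (by linarith) hn hn'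

end LevyModulus

section SubgaussianProcess

variable {Ω : Type*} [MeasurableSpace Ω] {P : Measure Ω} {E : Type*} [NormedAddCommGroup E]
  {X : ℝ≥0 → Ω → E} {K c : ℝ≥0} {A ℓ t : ℝ} {ω : Ω}

/-- A process with almost surely continuous paths started at `0` whose increments have Gaussian
tails with variance proxy linear in time. At `s = t` the exponent is `-ε ^ 2 / 0 = 0`, so that the
tail bound then only says `P {ω | ε < 0} ≤ K`. -/
structure IsSubgaussianProcess (X : ℝ≥0 → Ω → E) (K c : ℝ≥0) (P : Measure Ω) : Prop where
  ae_continuous : ∀ᵐ ω ∂P, Continuous fun t => X t ω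
  ae_zero : ∀ᵐ ω ∂P, X 0 ω = 0
  measure_lt_dist_le : ∀ (s t : ℝ≥0) (ε : ℝ), 0 ≤ ε →
    P {ω | ε < dist (X s ω) (X t ω)} ≤ K * ENNReal.ofReal (Real.exp (-ε ^ 2 / (c * dist s t)))

/-- A path started at `0` that is continuous and whose modulus of continuity on `[0, 1]` is at most
`h ↦ A √(h log (t / h))`: the larger `t`, the weaker the requirement and the likelier it is met by
a random path. -/
structure IsRegularPath (A t : ℝ) (w : ℝ≥0 → E) : Prop where
  continuous : Continuous w
  zero : w 0 = 0
  dist_le : ∀ a ≤ 1, ∀ b ≤ 1, dist (w a) (w b) ≤ A * √(dist a b * Real.log (t / dist a b))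

theorem IsRegularPath.mono {t' : ℝ} {w : ℝ≥0 → E} (hw : IsRegularPath A t w) (hA : 0 ≤ A)
    (ht : 0 < t) (htt' : t ≤ t') : IsRegularPath A t' w where
  continuous := hw.continuous
  zero := hw.zero
  dist_le a ha b hb := by
    rcases eq_or_ne a b with rfl | hne
    · simp
    have hpos : 0 < dist a b := dist_pos.2 hne
    exact (hw.dist_le a ha b hb).trans (by gcongr)

theorem isRegularPath_of_dyadicIncrementsLE {w : ℝ≥0 → E} (hcont : Continuous w) (h0 : w 0 = 0)
    (hA : 0 ≤ A) (ht : Real.exp 1 ≤ t)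
    (hw : DyadicIncrementsLE (fun s => w s.toNNReal)
      fun n => A * levyBound (2 * Real.log t) n) : IsRegularPath (38 * A) t w where
  continuous := hcont
  zero := h0
  dist_le a ha b hb := by
    rcases eq_or_ne a b with rfl | hne
    · simp
    have ht0 : 0 < t := (Real.exp_pos 1).trans_le ht
    have hlog : 1 ≤ Real.log t := (Real.le_log_iff_exp_le ht0).2 ht
    have hle := dist_le_of_dyadicIncrementsLE_levyBound
      (hcont.comp continuous_real_toNNReal).continuousOn hA (by linarith) hw
      ⟨a.2, NNReal.coe_le_one.2 ha⟩ ⟨b.2, NNReal.coe_le_one.2 hb⟩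
    simp only [Function.comp_apply, NNReal.val_eq_coe, Real.toNNReal_coe, Real.dist_eq,
      ← NNReal.dist_eq] at hle
    have hrate : 2 * dist a b * (2 * Real.log (dist a b)⁻¹ + 2 * Real.log t) =
        2 ^ 2 * (dist a b * Real.log (t / dist a b)) := by
      rw [Real.log_div ht0.ne' (dist_ne_zero.2 hne), Real.log_inv]
      ring
    rw [hrate, Real.sqrt_mul (by positivity), Real.sqrt_sq zero_le_two] at hle
    linarith

theorem dist_toNNReal_dyadic (n j : ℕ) :
    dist (j / 2 ^ n : ℝ).toNNReal ((j + 1 : ℕ) / 2 ^ n : ℝ).toNNReal = (2 ^ n)⁻¹ := by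
  rw [dist_comm, NNReal.dist_eq, Real.coe_toNNReal _ (by positivity),
    Real.coe_toNNReal _ (by positivity), ← sub_div, Nat.cast_succ, add_sub_cancel_left,
    abs_of_pos (by positivity), one_div]

theorem two_mul_exp_neg_two_le : 2 * Real.exp (-2) ≤ 1 / 2 := by
  have h : Real.exp (-2) = (Real.exp 1 ^ 2)⁻¹ := by rw [← Real.exp_nat_mul, ← Real.exp_neg]; simp
  have hlt : (2 : ℝ) ^ 2 < Real.exp 1 ^ 2 := by gcongr; exact Real.exp_one_gt_two
  rw [h]
  linarith [inv_anti₀ (by norm_num) hlt.le]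

theorem IsSubgaussianProcess.measure_levyBound_lt_dist_le (hX : IsSubgaussianProcess X K c P)
    (hc : 0 < c) (hℓ : 0 ≤ ℓ) (n j : ℕ) :
    P {ω | √(2 * c) * levyBound ℓ n <
      dist (X (j / 2 ^ n : ℝ).toNNReal ω) (X ((j + 1 : ℕ) / 2 ^ n : ℝ).toNNReal ω)} ≤
      ENNReal.ofReal (K * (Real.exp (-2 * ℓ) * Real.exp (-2) ^ n)) := by
  refine (hX.measure_lt_dist_le _ _ _ (by unfold levyBound; positivity)).trans_eq ?_
  have hexp : -(√(2 * c) * levyBound ℓ n) ^ 2 / (c * (2 ^ n)⁻¹) = -2 * ℓ + n * -2 := by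
    rw [levyBound, mul_pow, Real.sq_sqrt (by positivity), Real.sq_sqrt (by positivity)]
    field_simp
    ring
  rw [dist_toNNReal_dyadic, hexp, Real.exp_add, Real.exp_nat_mul,
    ENNReal.ofReal_mul K.coe_nonneg, ENNReal.ofReal_coe_nnreal]

theorem IsSubgaussianProcess.measure_exists_levyBound_lt_dist_le
    (hX : IsSubgaussianProcess X K c P) (hc : 0 < c) (hℓ : 0 ≤ ℓ) (n : ℕ) :
    P {ω | ∃ j : ℕ, j < 2 ^ n ∧ √(2 * c) * levyBound ℓ n <
      dist (X (j / 2 ^ n : ℝ).toNNReal ω) (X ((j + 1 : ℕ) / 2 ^ n : ℝ).toNNReal ω)} ≤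
      ENNReal.ofReal (K * Real.exp (-2 * ℓ) * (1 / 2) ^ n) := by
  have hunion := measure_biUnion_finset_le (μ := P) (Finset.range (2 ^ n)) fun j =>
    {ω | √(2 * c) * levyBound ℓ n <
      dist (X (j / 2 ^ n : ℝ).toNNReal ω) (X ((j + 1 : ℕ) / 2 ^ n : ℝ).toNNReal ω)}
  have hset (p : ℕ → Ω → Prop) :
      {ω | ∃ j < 2 ^ n, p j ω} = ⋃ j ∈ Finset.range (2 ^ n), {ω | p j ω} := by
    ext ω; simp
  rw [hset]
  refine hunion.trans ((Finset.sum_le_sum fun j _ =>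
    hX.measure_levyBound_lt_dist_le hc hℓ n j).trans ?_)
  rw [Finset.sum_const, Finset.card_range, nsmul_eq_mul, ← ENNReal.ofReal_natCast,
    ← ENNReal.ofReal_mul (by positivity)]
  refine ENNReal.ofReal_le_ofReal ?_
  calc ((2 ^ n : ℕ) : ℝ) * (K * (Real.exp (-2 * ℓ) * Real.exp (-2) ^ n))
      = K * Real.exp (-2 * ℓ) * (2 * Real.exp (-2)) ^ n := by push_cast; rw [mul_pow]; ring
    _ ≤ K * Real.exp (-2 * ℓ) * (1 / 2) ^ n := by gcongr; exact two_mul_exp_neg_two_le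

theorem IsSubgaussianProcess.measure_not_dyadicIncrementsLE_le (hX : IsSubgaussianProcess X K c P)
    (hc : 0 < c) (hℓ : 0 ≤ ℓ) :
    P {ω | ¬ DyadicIncrementsLE (fun s => X s.toNNReal ω) fun n => √(2 * c) * levyBound ℓ n} ≤
      ENNReal.ofReal (2 * K * Real.exp (-2 * ℓ)) := by
  have hset : {ω | ¬ DyadicIncrementsLE (fun s => X s.toNNReal ω)
      fun n => √(2 * c) * levyBound ℓ n} =
      ⋃ n : ℕ, {ω | ∃ j : ℕ, j < 2 ^ n ∧ √(2 * c) * levyBound ℓ n <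
        dist (X (j / 2 ^ n : ℝ).toNNReal ω) (X ((j + 1 : ℕ) / 2 ^ n : ℝ).toNNReal ω)} := by
    ext ω
    simp [DyadicIncrementsLE]
  rw [hset]
  refine (measure_iUnion_le _).trans ((ENNReal.tsum_le_tsum fun n =>
    hX.measure_exists_levyBound_lt_dist_le hc hℓ n).trans_eq ?_)
  rw [← ENNReal.ofReal_tsum_of_nonneg (fun n => by positivity)
    (summable_geometric_two.mul_left _), tsum_mul_left, tsum_geometric_two]
  congr 1
  ring

theorem IsSubgaussianProcess.measure_not_isRegularPath_le (hX : IsSubgaussianProcess X K c P)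
    (hc : 0 < c) (ht : Real.exp 1 ≤ t) (htK : 2 * K ≤ t) :
    P {ω | ¬ IsRegularPath (38 * √(2 * c)) t (X · ω)} ≤ ENNReal.ofReal (t ^ (-2 : ℝ)) := by
  have ht1 : 1 ≤ t := (Real.one_le_exp zero_le_one).trans ht
  have hsub : P {ω | ¬ IsRegularPath (38 * √(2 * c)) t (X · ω)} ≤
      P {ω | ¬ DyadicIncrementsLE (fun s => X s.toNNReal ω)
        fun n => √(2 * c) * levyBound (2 * Real.log t) n} := by
    refine measure_mono_ae ?_
    filter_upwards [hX.ae_continuous, hX.ae_zero] with ω hcont h0 hbad hgood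
    exact hbad (isRegularPath_of_dyadicIncrementsLE hcont h0 (Real.sqrt_nonneg _) ht hgood)
  refine hsub.trans ((hX.measure_not_dyadicIncrementsLE_le hc
    (mul_nonneg zero_le_two (Real.log_nonneg ht1))).trans (ENNReal.ofReal_le_ofReal ?_))
  have hexp : Real.exp (-2 * (2 * Real.log t)) = t ^ (-4 : ℝ) := by
    rw [Real.rpow_def_of_pos (by positivity)]
    ring_nf
  calc 2 * K * Real.exp (-2 * (2 * Real.log t)) ≤ t ^ (1 : ℝ) * t ^ (-4 : ℝ) := by
        rw [hexp, Real.rpow_one]; gcongr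
    _ = t ^ (-3 : ℝ) := by rw [← Real.rpow_add (by positivity)]; norm_num
    _ ≤ t ^ (-2 : ℝ) := Real.rpow_le_rpow_of_exponent_le ht1 (by norm_num)

theorem IsSubgaussianProcess.ae_eventually_isRegularPath (hX : IsSubgaussianProcess X K c P)
    (hc : 0 < c) :
    ∀ᵐ ω ∂P, ∀ᶠ t in Filter.atTop, IsRegularPath (38 * √(2 * c)) t (X · ω) := by
  have hlim : Filter.Tendsto (fun t : ℝ => ENNReal.ofReal (t ^ (-2 : ℝ))) Filter.atTop
      (nhds 0) := by
    simpa using ENNReal.tendsto_ofReal (tendsto_rpow_neg_atTop (y := 2) two_pos)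
  rw [ae_iff, ← nonpos_iff_eq_zero]
  refine ge_of_tendsto hlim ?_
  filter_upwards [Filter.eventually_ge_atTop (Real.exp 1), Filter.eventually_ge_atTop (2 * K : ℝ)]
    with t ht htK
  -- Regularity is monotone in `t`, so a path that is not eventually regular is irregular at every
  -- `t`; no Borel–Cantelli argument is needed.
  refine (measure_mono ?_).trans (hX.measure_not_isRegularPath_le hc ht htK)
  intro ω hω hreg
  refine hω ?_
  filter_upwards [Filter.eventually_ge_atTop t] with s hs
  exact hreg.mono (by positivity) ((Real.exp_pos 1).trans_le ht) hs

end SubgaussianProcess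

section Brownian

variable {Ω : Type*} [MeasurableSpace Ω] {P : Measure Ω}

theorem hasSubgaussianMGF_of_hasLaw_gaussianReal {Y : Ω → ℝ} {v : ℝ≥0}
    (hY : HasLaw Y (gaussianReal 0 v) P) : HasSubgaussianMGF Y v P where
  integrable_exp_mul t := by
    have h : Integrable (fun y => Real.exp (t * y)) (P.map Y) := by
      rw [hY.map_eq]
      exact integrable_exp_mul_gaussianReal t
    exact h.comp_aemeasurable hY.aemeasurable
  mgf_le t := by rw [mgf_gaussianReal hY.map_eq, zero_mul, zero_add]

theorem measure_lt_abs_le_of_hasSubgaussianMGF [IsFiniteMeasure P] {Y : Ω → ℝ} {v : ℝ≥0}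
    (hY : HasSubgaussianMGF Y v P) {ε : ℝ} (hε : 0 ≤ ε) :
    P {ω | ε < |Y ω|} ≤ ENNReal.ofReal (2 * Real.exp (-ε ^ 2 / (2 * v))) := by
  have hsub : {ω | ε < |Y ω|} ⊆ {ω | ε ≤ Y ω} ∪ {ω | ε ≤ (-Y) ω} :=
    fun ω hω => (lt_abs.1 (Set.mem_ofPred.1 hω)).imp (fun h => h.le) fun h => h.le
  rw [← ofReal_measureReal]
  gcongr
  linarith [measureReal_mono (μ := P) hsub, measureReal_union_le (μ := P) {ω | ε ≤ Y ω}
    {ω | ε ≤ (-Y) ω}, hY.measure_ge_le hε, hY.neg.measure_ge_le hε]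

theorem exists_lt_abs_apply_of_lt_norm {ι : Type*} [Fintype ι] {v : EuclideanSpace ℝ ι} {ε : ℝ}
    (hε : 0 ≤ ε) (hv : √(Fintype.card ι) * ε < ‖v‖) : ∃ i, ε < |v i| := by
  by_contra! hle
  refine hv.not_ge ?_
  rw [EuclideanSpace.norm_eq, ← Real.sqrt_sq hε, ← Real.sqrt_mul (by positivity)]
  gcongr
  calc ∑ i, ‖v i‖ ^ 2 ≤ ∑ _i : ι, ε ^ 2 := by gcongr with i; exact hle i
    _ = Fintype.card ι * ε ^ 2 := by simp

theorem measure_lt_norm_le_of_hasSubgaussianMGF [IsFiniteMeasure P] {ι : Type*} [Fintype ι]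
    {V : Ω → EuclideanSpace ℝ ι} {v : ℝ≥0} (hV : ∀ i, HasSubgaussianMGF (fun ω => V ω i) v P)
    {ε : ℝ} (hε : 0 ≤ ε) :
    P {ω | ε < ‖V ω‖} ≤
      2 * Fintype.card ι * ENNReal.ofReal (Real.exp (-ε ^ 2 / (2 * Fintype.card ι * v))) := by
  rcases isEmpty_or_nonempty ι with hι | hι
  · simp [EuclideanSpace.norm_eq, hε.not_gt]
  have hsub : {ω | ε < ‖V ω‖} ⊆ ⋃ i, {ω | ε / √(Fintype.card ι) < |V ω i|} := fun ω hω =>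
    Set.mem_iUnion.2 (exists_lt_abs_apply_of_lt_norm (by positivity)
      (by rwa [mul_div_cancel₀ _ (by positivity)]))
  refine (measure_mono hsub).trans ((measure_iUnion_fintype_le _ _).trans ((Finset.sum_le_sum
    fun i _ => measure_lt_abs_le_of_hasSubgaussianMGF (hV i) (by positivity)).trans_eq ?_))
  rw [Finset.sum_const, Finset.card_univ, nsmul_eq_mul, ENNReal.ofReal_mul zero_le_two,
    ENNReal.ofReal_ofNat, div_pow, Real.sq_sqrt (by positivity), ← neg_div, div_div,
    mul_left_comm, ← mul_assoc, ← mul_assoc]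
  ring_nf

theorem isSubgaussianProcess_of_isBrownianReal [IsFiniteMeasure P] {ι : Type*} [Fintype ι]
    {W : ℝ≥0 → Ω → EuclideanSpace ℝ ι} (hW : ∀ i, IsBrownianReal (fun t ω => W t ω i) P) :
    IsSubgaussianProcess W (2 * Fintype.card ι) (2 * Fintype.card ι) P where
  ae_continuous := by
    filter_upwards [ae_all_iff.2 fun i => (hW i).cont] with ω hω
    exact (PiLp.continuous_toLp 2 _).comp (continuous_pi hω)
  ae_zero := by
    filter_upwards [ae_all_iff.2 fun i => (hW i).eval_zero_ae_eq_zero] with ω hω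
    ext i
    exact hω i
  measure_lt_dist_le s t ε hε := by
    have hinc (i : ι) : HasSubgaussianMGF (fun ω => (W s ω - W t ω) i) (nndist s t) P :=
      hasSubgaussianMGF_of_hasLaw_gaussianReal ((hW i).hasLaw_sub s t)
    simpa [dist_eq_norm (W s _)] using measure_lt_norm_le_of_hasSubgaussianMGF hinc hε

end Brownian

section Score

variable {α σ x s : ℝ}

/-- The standardising change of variables `s ↦ (α s - x) / (σ √s)`: it pushes the smoothing kernel
forward to the standard Gaussian density. -/
noncomputable def congaScore (α σ x s : ℝ) : ℝ := (α * s - x) / (σ * √s)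

theorem hasDerivAt_congaScore (hσ : 0 < σ) (hs : 0 < s) :
    HasDerivAt (congaScore α σ x) ((x + α * s) / (2 * σ * s ^ (3 / 2 : ℝ))) s := by
  have hnum : HasDerivAt (fun s => α * s - x) α s := by
    simpa using ((hasDerivAt_id s).const_mul α).sub_const x
  have hden : HasDerivAt (fun s => σ * √s) (σ * (1 / (2 * √s))) s :=
    (Real.hasDerivAt_sqrt hs.ne').const_mul σ
  have hpow : s ^ (3 / 2 : ℝ) = s * √s := by
    rw [Real.sqrt_eq_rpow, ← Real.rpow_one_add' hs.le (by norm_num)]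
    norm_num
  convert! hnum.div hden (by positivity) using 1
  rw [hpow]
  field_simp
  rw [Real.sq_sqrt hs.le]
  ring

theorem strictMonoOn_congaScore (hα : 0 < α) (hσ : 0 < σ) (hx : 0 < x) :
    StrictMonoOn (congaScore α σ x) (Set.Ioi 0) := by
  refine strictMonoOn_of_deriv_pos (convex_Ioi 0)
    (fun s hs => (hasDerivAt_congaScore hσ hs).continuousAt.continuousWithinAt) fun s hs => ?_
  rw [interior_Ioi, Set.mem_Ioi] at hs
  rw [(hasDerivAt_congaScore hσ hs).deriv]
  positivity

theorem image_congaScore (hα : 0 < α) (hσ : 0 < σ) (hx : 0 < x) :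
    congaScore α σ x '' Set.Ioi 0 = Set.univ := by
  refine Set.eq_univ_of_forall fun y => ?_
  -- `√s` is the positive root of `α z ^ 2 - σ y z - x = 0`.
  set d := √((σ * y) ^ 2 + 4 * α * x)
  have hd2 : d ^ 2 = (σ * y) ^ 2 + 4 * α * x := Real.sq_sqrt (by positivity)
  have hdy : |σ * y| < d := by
    rw [← Real.sqrt_sq_eq_abs]
    exact Real.sqrt_lt_sqrt (sq_nonneg _) (by linarith [mul_pos hα hx])
  set z := (σ * y + d) / (2 * α) with hz
  have hz0 : 0 < z := div_pos (by linarith [(abs_lt.1 hdy).1, neg_abs_le (σ * y)]) (by positivity)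
  refine ⟨z ^ 2, Set.mem_Ioi.2 (by positivity), ?_⟩
  rw [congaScore, Real.sqrt_sq hz0.le, div_eq_iff (by positivity), hz]
  field_simp
  linear_combination hd2

theorem mul_sqrt_le_abs_congaScore (hα : 0 < α) (hσ : 0 < σ) (hx : 0 < x) (hs : 0 < s) :
    α * √s ≤ σ * |congaScore α σ x s| + √(α * x) := by
  have hfactor : (α * √s - √(α * x)) * (α * √s + √(α * x)) = σ * congaScore α σ x s * (α * √s) := by
    rw [mul_comm, ← sq_sub_sq, mul_pow, Real.sq_sqrt hs.le, Real.sq_sqrt (by positivity),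
      congaScore]
    field_simp
  have hle : σ * congaScore α σ x s * (α * √s) ≤
      σ * |congaScore α σ x s| * (α * √s + √(α * x)) := by
    gcongr
    · exact le_abs_self _
    · exact le_add_of_nonneg_right (Real.sqrt_nonneg _)
  rw [← hfactor] at hle
  linarith [le_of_mul_le_mul_right hle (by positivity)]

theorem abs_sub_div_le_congaScore (hα : 0 < α) (hσ : 0 < σ) (hx : 0 < x) (hs : 0 < s) :
    |s - x / α| ≤ σ ^ 2 / α ^ 2 * congaScore α σ x s ^ 2 +
      σ * √(α * x) / α ^ 2 * ((1 + congaScore α σ x s ^ 2) / 2) := by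
  have hdev : s - x / α = σ * √s * congaScore α σ x s / α := by
    rw [congaScore]
    field_simp
  rw [hdev, abs_div, abs_mul, abs_of_pos (by positivity : 0 < σ * √s), abs_of_pos hα,
    ← sq_abs (congaScore α σ x s)]
  have hsq := mul_sqrt_le_abs_congaScore hα hσ hx hs
  have hy := abs_nonneg (congaScore α σ x s)
  generalize |congaScore α σ x s| = y at *
  calc σ * √s * y / α = (α * √s) * (σ * y) / α ^ 2 := by field_simp
    _ ≤ (σ * y + √(α * x)) * (σ * y) / α ^ 2 := by gcongr
    _ = σ ^ 2 / α ^ 2 * y ^ 2 + σ * √(α * x) / α ^ 2 * y := by ring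
    _ ≤ _ := by gcongr; linarith [sq_nonneg (y - 1)]

end Score

section Kernel

variable {α t x : ℝ}

theorem congaSigma_pos (hα₀ : 0 < α) (hα₁ : α < 1) (ht : 0 < t) : 0 < congaSigma α t := by
  have := sub_pos.2 hα₁
  unfold congaSigma
  positivity

theorem congaKernel_eq (hσ : 0 < congaSigma α t) {s : ℝ} (hs : 0 < s) :
    congaKernel α t x s = (x + α * s) / (2 * congaSigma α t * s ^ (3 / 2 : ℝ)) *
      gaussianPDFReal 0 1 (congaScore α (congaSigma α t) x s) := by
  have hexp : -(x - α * s) ^ 2 / (2 * congaSigma α t ^ 2 * s) =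
      -(congaScore α (congaSigma α t) x s - 0) ^ 2 / (2 * (1 : ℝ≥0)) := by
    rw [sub_zero, congaScore, div_pow, mul_pow, Real.sq_sqrt hs.le, NNReal.coe_one]
    field_simp
    ring
  rw [congaKernel, gaussianPDFReal, hexp, NNReal.coe_one, mul_one (2 * Real.pi), mul_assoc,
    mul_left_comm]

theorem congaKernel_nonneg (hα : 0 ≤ α) (hx : 0 ≤ x) {s : ℝ} (hs : 0 ≤ s) :
    0 ≤ congaKernel α t x s := by
  have : 0 ≤ congaSigma α t := by unfold congaSigma; positivity
  unfold congaKernel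
  positivity

section ChangeOfVariables

variable {F : Type*} [NormedAddCommGroup F] [NormedSpace ℝ F] (g : ℝ → F)

theorem congaKernel_smul_eqOn (hσ : 0 < congaSigma α t) :
    Set.EqOn (fun s => congaKernel α t x s • g (congaScore α (congaSigma α t) x s))
      (fun s => ((x + α * s) / (2 * congaSigma α t * s ^ (3 / 2 : ℝ))) •
        (gaussianPDFReal 0 1 (congaScore α (congaSigma α t) x s) •
          g (congaScore α (congaSigma α t) x s))) (Set.Ioi 0) :=
  fun s hs => by simp only [congaKernel_eq hσ hs, mul_smul]

theorem integrableOn_congaKernel_smul_iff (hα : 0 < α) (hσ : 0 < congaSigma α t) (hx : 0 < x) :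
    IntegrableOn (fun s => congaKernel α t x s • g (congaScore α (congaSigma α t) x s))
      (Set.Ioi 0) ↔ Integrable g (gaussianReal 0 1) := by
  rw [integrableOn_congr_fun (congaKernel_smul_eqOn g hσ) measurableSet_Ioi,
    ← integrableOn_image_iff_integrableOn_deriv_smul_of_monotoneOn measurableSet_Ioi
      (fun s hs => (hasDerivAt_congaScore hσ hs).hasDerivWithinAt)
      (strictMonoOn_congaScore hα hσ hx).monotoneOn (fun y => gaussianPDFReal 0 1 y • g y),
    image_congaScore hα hσ hx, integrableOn_univ, gaussianReal_of_var_ne_zero 0 one_ne_zero,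
    integrable_withDensity_iff_integrable_smul' (measurable_gaussianPDF 0 1)
      (ae_of_all _ fun _ => ENNReal.ofReal_lt_top)]
  simp only [toReal_gaussianPDF]

theorem integral_congaKernel_smul (hα : 0 < α) (hσ : 0 < congaSigma α t) (hx : 0 < x) :
    ∫ s in Set.Ioi 0, congaKernel α t x s • g (congaScore α (congaSigma α t) x s) =
      ∫ y, g y ∂gaussianReal 0 1 := by
  rw [setIntegral_congr_fun measurableSet_Ioi (congaKernel_smul_eqOn g hσ),
    ← integral_image_eq_integral_deriv_smul_of_monotoneOn measurableSet_Ioi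
      (fun s hs => (hasDerivAt_congaScore hσ hs).hasDerivWithinAt)
      (strictMonoOn_congaScore hα hσ hx).monotoneOn (fun y => gaussianPDFReal 0 1 y • g y),
    image_congaScore hα hσ hx, setIntegral_univ,
    integral_gaussianReal_eq_integral_smul one_ne_zero]

end ChangeOfVariables

theorem integrableOn_congaKernel (hα : 0 < α) (hσ : 0 < congaSigma α t) (hx : 0 < x) :
    IntegrableOn (congaKernel α t x) (Set.Ioi 0) := by
  simpa using (integrableOn_congaKernel_smul_iff (fun _ => (1 : ℝ)) hα hσ hx).2
    (integrable_const 1)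

theorem integral_congaKernel (hα : 0 < α) (hσ : 0 < congaSigma α t) (hx : 0 < x) :
    ∫ s in Set.Ioi 0, congaKernel α t x s = 1 := by
  simpa using integral_congaKernel_smul (fun _ => (1 : ℝ)) hα hσ hx

theorem integrable_sq_gaussianReal : Integrable (fun y => y ^ 2) (gaussianReal 0 1) :=
  (memLp_id_gaussianReal 2).integrable_sq

theorem integral_sq_gaussianReal : ∫ y, y ^ 2 ∂gaussianReal 0 1 = 1 := by
  rw [← variance_of_integral_eq_zero aemeasurable_id' integral_id_gaussianReal,
    variance_fun_id_gaussianReal, NNReal.coe_one]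

theorem ae_congaKernel_mul_abs_sub_le (hα : 0 < α) (hσ : 0 < congaSigma α t) (hx : 0 < x) :
    ∀ᵐ s ∂volume.restrict (Set.Ioi 0), congaKernel α t x s * |s - x / α| ≤
      congaKernel α t x s • (congaSigma α t ^ 2 / α ^ 2 * congaScore α (congaSigma α t) x s ^ 2 +
        congaSigma α t * √(α * x) / α ^ 2 *
          ((1 + congaScore α (congaSigma α t) x s ^ 2) / 2)) := by
  filter_upwards [ae_restrict_mem measurableSet_Ioi] with s hs
  exact mul_le_mul_of_nonneg_left (abs_sub_div_le_congaScore hα hσ hx hs)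
    (congaKernel_nonneg hα.le hx.le (le_of_lt hs))

theorem integrableOn_congaKernel_mul_abs_sub (hα : 0 < α) (hσ : 0 < congaSigma α t)
    (hx : 0 < x) : IntegrableOn (fun s => congaKernel α t x s * |s - x / α|) (Set.Ioi 0) := by
  have hsq := integrable_sq_gaussianReal
  have hdom := (integrableOn_congaKernel_smul_iff (fun y => congaSigma α t ^ 2 / α ^ 2 * y ^ 2 +
    congaSigma α t * √(α * x) / α ^ 2 * ((1 + y ^ 2) / 2)) hα hσ hx).2 (by fun_prop)
  refine hdom.mono' ((integrableOn_congaKernel hα hσ hx).aestronglyMeasurable.mul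
    (by fun_prop : Continuous fun s : ℝ => |s - x / α|).aestronglyMeasurable) ?_
  filter_upwards [ae_congaKernel_mul_abs_sub_le hα hσ hx, ae_restrict_mem measurableSet_Ioi]
    with s hle hs
  rwa [Real.norm_of_nonneg
    (mul_nonneg (congaKernel_nonneg hα.le hx.le (le_of_lt hs)) (abs_nonneg _))]

theorem integral_congaKernel_mul_abs_sub_le (hα : 0 < α) (hσ : 0 < congaSigma α t)
    (hx : 0 < x) : ∫ s in Set.Ioi 0, congaKernel α t x s * |s - x / α| ≤
      congaSigma α t ^ 2 / α ^ 2 + congaSigma α t * √(α * x) / α ^ 2 := by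
  have hsq := integrable_sq_gaussianReal
  have hdom := (integrableOn_congaKernel_smul_iff (fun y => congaSigma α t ^ 2 / α ^ 2 * y ^ 2 +
    congaSigma α t * √(α * x) / α ^ 2 * ((1 + y ^ 2) / 2)) hα hσ hx).2 (by fun_prop)
  refine (integral_mono_ae (integrableOn_congaKernel_mul_abs_sub hα hσ hx) hdom
    (ae_congaKernel_mul_abs_sub_le hα hσ hx)).trans_eq ?_
  rw [integral_congaKernel_smul (fun y => congaSigma α t ^ 2 / α ^ 2 * y ^ 2 +
    congaSigma α t * √(α * x) / α ^ 2 * ((1 + y ^ 2) / 2)) hα hσ hx,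
    integral_add (by fun_prop) (by fun_prop), integral_const_mul, integral_const_mul,
    integral_div, integral_add (by fun_prop) hsq, integral_sq_gaussianReal]
  norm_num

theorem integral_congaKernel_mul_abs_sub_le_sqrt (hα₀ : 0 < α) (hα₁ : α < 1) (ht : 0 < t)
    (hx : 1 / t ≤ x) :
    ∫ s in Set.Ioi 0, congaKernel α t x s * |s - x / α| ≤ 2 / α * √(x / t) := by
  have hx0 : 0 < x := (by positivity : 0 < 1 / t).trans_le hx
  refine (integral_congaKernel_mul_abs_sub_le hα₀ (congaSigma_pos hα₀ hα₁ ht) hx0).trans ?_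
  have hvar : 0 ≤ α * (1 - α) := mul_nonneg hα₀.le (sub_nonneg.2 hα₁.le)
  have hfst : congaSigma α t ^ 2 / α ^ 2 ≤ 1 / α * √(x / t) := by
    have hle : 1 / t ≤ √(x / t) := by
      refine Real.le_sqrt_of_sq_le ?_
      rw [sq, mul_one_div]
      gcongr
    calc congaSigma α t ^ 2 / α ^ 2 = (1 - α) / α * (1 / t) := by
          rw [congaSigma, div_pow, Real.sq_sqrt hvar, Real.sq_sqrt ht.le]
          field_simp
      _ ≤ 1 / α * √(x / t) := by gcongr; linarith
  have hsnd : congaSigma α t * √(α * x) / α ^ 2 ≤ 1 / α * √(x / t) := by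
    calc congaSigma α t * √(α * x) / α ^ 2 = √(α ^ 2 * (1 - α)) * √(x / t) / α ^ 2 := by
          rw [congaSigma, ← Real.sqrt_div hvar, ← Real.sqrt_mul (by positivity),
            ← Real.sqrt_mul (by nlinarith)]
          ring_nf
      _ ≤ α * √(x / t) / α ^ 2 := by
          gcongr
          exact Real.sqrt_le_iff.2 ⟨hα₀.le, mul_le_of_le_one_right (by positivity) (by linarith)⟩
      _ = 1 / α * √(x / t) := by field_simp
  linarith [(by ring : 2 / α * √(x / t) = 1 / α * √(x / t) + 1 / α * √(x / t))]

end Kernel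

section Smoothing

variable {E : Type*} [NormedAddCommGroup E] [NormedSpace ℝ E]

theorem norm_integral_smul_sub_le_integral_mul [CompleteSpace E] {S : Type*} [MeasurableSpace S]
    {μ : Measure S} {k ψ : S → ℝ} {g : S → E} {c : E} (hk0 : 0 ≤ᵐ[μ] k) (hk : Integrable k μ)
    (hk1 : ∫ s, k s ∂μ = 1) (hg : AEStronglyMeasurable g μ) (hgc : ∀ᵐ s ∂μ, ‖g s - c‖ ≤ ψ s)
    (hkψ : Integrable (fun s => k s * ψ s) μ) :
    ‖(∫ s, k s • g s ∂μ) - c‖ ≤ ∫ s, k s * ψ s ∂μ := by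
  have hbound : ∀ᵐ s ∂μ, ‖k s • (g s - c)‖ ≤ k s * ψ s := by
    filter_upwards [hk0, hgc] with s hks hgs
    rw [norm_smul, Real.norm_of_nonneg hks]
    exact mul_le_mul_of_nonneg_left hgs hks
  have hdiff : Integrable (fun s => k s • (g s - c)) μ :=
    hkψ.mono' (hk.aestronglyMeasurable.smul (hg.sub aestronglyMeasurable_const)) hbound
  have hsplit : (∫ s, k s • g s ∂μ) - c = ∫ s, k s • (g s - c) ∂μ := by
    have hadd := integral_add hdiff (hk.smul_const c)
    rw [integral_smul_const, hk1, one_smul] at hadd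
    rw [sub_eq_iff_eq_add, ← hadd]
    simp only [smul_sub, sub_add_cancel]
  rw [hsplit]
  exact norm_integral_le_of_norm_le hkψ hbound

theorem intervalIntegral_smul_eq_integral_Ioi (k : ℝ → ℝ) {w : ℝ≥0 → E} (hw : w 0 = 0) :
    ∫ s in (0 : ℝ)..1, k s • w (Real.toNNReal (1 - s)) =
      ∫ s in Set.Ioi 0, k s • w (Real.toNNReal (1 - s)) := by
  rw [intervalIntegral.integral_of_le zero_le_one]
  refine (setIntegral_eq_of_subset_of_forall_sdiff_eq_zero measurableSet_Ioi
    Set.Ioc_subset_Ioi_self fun s hs => ?_).symm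
  have hs1 : 1 ≤ s := not_lt.1 fun h => hs.2 ⟨hs.1, h.le⟩
  rw [Real.toNNReal_of_nonpos (sub_nonpos.2 hs1), hw, smul_zero]

/-- The error `|u_t(x) - w(1 - x/α)|` for a path `w` with values in an arbitrary normed space; for
planar paths this is `congaError`. -/
noncomputable def smoothingError (α t : ℝ) (w : ℝ≥0 → E) (x : ℝ) : ℝ :=
  ‖(∫ s in (0 : ℝ)..1, congaKernel α t x s • w (Real.toNNReal (1 - s))) -
    w (Real.toNNReal (1 - x / α))‖

end Smoothing

section Rate

variable {α t x : ℝ}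

theorem congaRate_nonneg (t x : ℝ) : 0 ≤ congaRate t x := Real.sqrt_nonneg _

theorem congaRate_eq (t x : ℝ) : congaRate t x = √(√(x / t) * Real.log (t / x)) := by
  rw [congaRate, ← Real.sqrt_eq_rpow, ← mul_neg, ← Real.log_inv, inv_div]

theorem congaRate_le (ht : Real.exp 2 ≤ t) (hx : 0 < x) (hx1 : x ≤ 1) :
    congaRate t x ≤ t ^ (-(1 / 4) : ℝ) * √(Real.log t) := by
  have ht0 : 0 < t := (Real.exp_pos 2).trans_le ht
  have hlog : 2 ≤ Real.log t := (Real.le_log_iff_exp_le ht0).2 ht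
  have hpow : t ^ (-(1 / 4) : ℝ) = √(√t)⁻¹ := by
    simp only [Real.sqrt_eq_rpow, ← Real.rpow_neg_one, ← Real.rpow_mul ht0.le]
    norm_num
  have hlogx : Real.log (t / x) = Real.log t + 2 * Real.log (√x)⁻¹ := by
    rw [Real.log_div ht0.ne' hx.ne', Real.log_inv, Real.log_sqrt hx.le]
    ring
  have hy : 0 < √x := Real.sqrt_pos.2 hx
  have hinv : √x * Real.log (√x)⁻¹ ≤ 1 - √x := by
    calc √x * Real.log (√x)⁻¹ ≤ √x * ((√x)⁻¹ - 1) := by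
          gcongr; exact Real.log_le_sub_one_of_pos (inv_pos.2 hy)
      _ = 1 - √x := by field_simp
  have hmain : √x * Real.log (t / x) ≤ Real.log t := by
    nlinarith [Real.sqrt_le_one.2 hx1]
  rw [congaRate_eq, hpow, ← Real.sqrt_mul (by positivity), Real.sqrt_div hx.le]
  refine Real.sqrt_le_sqrt ?_
  calc √x / √t * Real.log (t / x) = (√t)⁻¹ * (√x * Real.log (t / x)) := by ring
    _ ≤ (√t)⁻¹ * Real.log t := by gcongr

theorem sqrt_mul_log_div_le {h m : ℝ} (hh : 0 ≤ h) (hm : 0 < m) (hmt : Real.exp 1 * m ≤ t) :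
    √(h * Real.log (t / h)) ≤ (1 + h / m) * √(m * Real.log (t / m)) := by
  have ht : 0 < t := (by positivity : 0 < Real.exp 1 * m).trans_le hmt
  have hlog : 1 ≤ Real.log (t / m) :=
    (Real.le_log_iff_exp_le (by positivity)).2 ((le_div_iff₀ hm).2 hmt)
  have hchange : h * Real.log (t / h) ≤ h * Real.log (t / m) + m := by
    rcases hh.eq_or_lt with rfl | hh
    · simpa using hm.le
    calc h * Real.log (t / h) = h * Real.log (t / m) + h * Real.log (m / h) := by
          rw [Real.log_div ht.ne' hh.ne', Real.log_div ht.ne' hm.ne', Real.log_div hm.ne' hh.ne']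
          ring
      _ ≤ h * Real.log (t / m) + h * (m / h - 1) := by
          gcongr; exact Real.log_le_sub_one_of_pos (by positivity)
      _ ≤ h * Real.log (t / m) + m := by rw [mul_sub, mul_div_cancel₀ m hh.ne']; linarith
  calc √(h * Real.log (t / h)) ≤ √((1 + h / m) * (m * Real.log (t / m))) := by
        refine Real.sqrt_le_sqrt (hchange.trans ?_)
        have hexpand : (1 + h / m) * (m * Real.log (t / m)) = (m + h) * Real.log (t / m) := by
          field_simp
        rw [hexpand]
        nlinarith
    _ = √(1 + h / m) * √(m * Real.log (t / m)) := Real.sqrt_mul (by positivity) _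
    _ ≤ (1 + h / m) * √(m * Real.log (t / m)) := by
        gcongr
        exact Real.sqrt_le_iff.2 ⟨by positivity,
          le_self_pow₀ (le_add_of_nonneg_right (by positivity)) two_ne_zero⟩

theorem sqrt_mul_log_le_two_mul_congaRate (ht : 1 ≤ t) (hx : 0 < x) (hx1 : x ≤ 1) :
    √(√(x / t) * Real.log (t / √(x / t))) ≤ 2 * congaRate t x := by
  have ht0 : 0 < t := by linarith
  have hlog : Real.log (t / √(x / t)) ≤ 2 ^ 2 * Real.log (t / x) := by
    rw [Real.log_div ht0.ne' (by positivity), Real.log_sqrt (by positivity),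
      Real.log_div hx.ne' ht0.ne', Real.log_div ht0.ne' hx.ne']
    linarith [Real.log_nonneg ht, Real.log_nonpos hx.le hx1]
  calc √(√(x / t) * Real.log (t / √(x / t)))
      ≤ √(2 ^ 2 * (√(x / t) * Real.log (t / x))) := by rw [mul_left_comm]; gcongr
    _ = 2 * congaRate t x := by
        rw [Real.sqrt_mul (by positivity), Real.sqrt_sq zero_le_two, congaRate_eq]

end Rate

section Domain

variable {α t : ℝ}

theorem mul_log_lt_of_mem_congaAdmissible {M x : ℝ} (hα₀ : 0 < α) (hα₁ : α < 1) (hM : 0 ≤ M)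
    (ht : 1 ≤ t) (hx : x ∈ congaAdmissible α M t) : M * (α * (1 - α)) * Real.log t < t * x := by
  obtain ⟨⟨hx0, hxα⟩, hadm⟩ := hx
  have ht0 : 0 < t := by linarith
  have hα : 0 < α * (1 - α) := mul_pos hα₀ (sub_pos.2 hα₁)
  have hσ : congaSigma α t ^ 2 = α * (1 - α) / t := by
    rw [congaSigma, div_pow, Real.sq_sqrt hα.le, Real.sq_sqrt ht0.le]
  rw [congaWindow, mul_inv_cancel_left₀ hα₀.ne', hσ, Real.sqrt_lt' hx0] at hadm
  have hle : α * (1 - α) / t * x ≤ t⁻¹ := by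
    rw [div_mul_eq_mul_div, div_eq_mul_inv]
    exact mul_le_of_le_one_left (by positivity) (by nlinarith)
  have hlog : Real.log t ≤ -Real.log (α * (1 - α) / t * x) := by
    linarith [Real.log_le_log (by positivity) hle, Real.log_inv t]
  have hlt : M * (α * (1 - α) / t * x) * Real.log t < x ^ 2 := by
    refine lt_of_le_of_lt ?_ hadm
    rw [← mul_neg]
    gcongr
  have hscale : M * (α * (1 - α)) * Real.log t * x < t * x * x := by
    calc M * (α * (1 - α)) * Real.log t * x
        = t * (M * (α * (1 - α) / t * x) * Real.log t) := by field_simp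
      _ < t * x ^ 2 := by gcongr
      _ = t * x * x := by ring
  exact lt_of_mul_lt_mul_right hscale hx0.le

theorem eventually_congaAdmissible_subset_Icc {M : ℝ} (hα₀ : 0 < α) (hα₁ : α < 1) (hM : 0 < M) :
    ∀ᶠ t in Filter.atTop, congaAdmissible α M t ⊆ Set.Icc (1 / t) α := by
  have hpos : 0 < M * (α * (1 - α)) := mul_pos hM (mul_pos hα₀ (sub_pos.2 hα₁))
  filter_upwards [Filter.eventually_ge_atTop 1,
    (Real.tendsto_log_atTop.const_mul_atTop hpos).eventually_ge_atTop 1] with t ht hlog x hx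
  refine ⟨(div_le_iff₀' (by linarith)).2 ?_, hx.1.2⟩
  exact hlog.trans (mul_log_lt_of_mem_congaAdmissible hα₀ hα₁ hM.le ht hx).le

theorem Icc_rpow_neg_subset_Icc {β : ℝ} (hβ : β ≤ 1) (ht : 1 ≤ t) :
    Set.Icc (t ^ (-β)) α ⊆ Set.Icc (1 / t) α := by
  refine Set.Icc_subset_Icc_left ?_
  rw [one_div, ← Real.rpow_neg_one]
  exact Real.rpow_le_rpow_of_exponent_le ht (by linarith)

end Domain

section SmoothingError

variable {E : Type*} [NormedAddCommGroup E] {A α t x : ℝ} {w : ℝ≥0 → E}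

theorem IsRegularPath.dist_le_congaRate (hw : IsRegularPath A t w) (hA : 0 ≤ A)
    (ht : Real.exp 1 ≤ t) (hx : 0 < x) (hx1 : x ≤ 1) {a b : ℝ≥0} (ha : a ≤ 1) (hb : b ≤ 1) :
    dist (w a) (w b) ≤ 2 * A * congaRate t x * (1 + dist a b / √(x / t)) := by
  have ht1 : 1 ≤ t := (Real.one_le_exp zero_le_one).trans ht
  have ht0 : 0 < t := by linarith
  have hm : √(x / t) ≤ 1 := Real.sqrt_le_one.2 (div_le_one_of_le₀ (hx1.trans ht1) ht0.le)
  have hmt : Real.exp 1 * √(x / t) ≤ t :=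
    (mul_le_of_le_one_right (Real.exp_pos 1).le hm).trans ht
  calc dist (w a) (w b) ≤ A * √(dist a b * Real.log (t / dist a b)) := hw.dist_le a ha b hb
    _ ≤ A * ((1 + dist a b / √(x / t)) * (2 * congaRate t x)) := by
        gcongr
        exact (sqrt_mul_log_div_le dist_nonneg (by positivity) hmt).trans (by
          gcongr; exact sqrt_mul_log_le_two_mul_congaRate ht1 hx hx1)
    _ = 2 * A * congaRate t x * (1 + dist a b / √(x / t)) := by ring

theorem IsRegularPath.norm_sub_le_congaRate (hw : IsRegularPath A t w) (hA : 0 ≤ A)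
    (ht : Real.exp 1 ≤ t) (hx : 0 < x) (hx1 : x ≤ 1) (hα : 0 < α) {s : ℝ} (hs : 0 < s) :
    ‖w (1 - s).toNNReal - w (1 - x / α).toNNReal‖ ≤
      2 * A * congaRate t x * (1 + |s - x / α| / √(x / t)) := by
  have hdist : dist (1 - s).toNNReal (1 - x / α).toNNReal ≤ |s - x / α| := by
    refine (Real.lipschitzWith_toNNReal.dist_le_mul _ _).trans_eq ?_
    rw [NNReal.coe_one, one_mul, dist_sub_left, Real.dist_eq]
  rw [← dist_eq_norm]
  refine (hw.dist_le_congaRate hA ht hx hx1 (Real.toNNReal_le_one.2 (by linarith))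
    (Real.toNNReal_le_one.2 (sub_le_self _ (by positivity)))).trans ?_
  have := congaRate_nonneg t x
  gcongr

theorem IsRegularPath.smoothingError_le [NormedSpace ℝ E] [CompleteSpace E]
    (hw : IsRegularPath A t w) (hA : 0 ≤ A) (hα₀ : 0 < α) (hα₁ : α < 1) (ht : Real.exp 1 ≤ t)
    (hx : x ∈ Set.Icc (1 / t) α) :
    smoothingError α t w x ≤ 2 * A * (1 + 2 / α) * congaRate t x := by
  have ht0 : 0 < t := (Real.exp_pos 1).trans_le ht
  have hx0 : 0 < x := (by positivity : 0 < 1 / t).trans_le hx.1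
  have hσ := congaSigma_pos hα₀ hα₁ ht0
  have hk := integrableOn_congaKernel hα₀ hσ hx0
  have hkabs := integrableOn_congaKernel_mul_abs_sub hα₀ hσ hx0
  have hmean : (∫ s in Set.Ioi 0, congaKernel α t x s * |s - x / α|) / √(x / t) ≤ 2 / α :=
    div_le_of_le_mul₀ (Real.sqrt_nonneg _) (by positivity)
      (integral_congaKernel_mul_abs_sub_le_sqrt hα₀ hα₁ ht0 hx.1)
  have hψ : (fun s => congaKernel α t x s *
      (2 * A * congaRate t x * (1 + |s - x / α| / √(x / t)))) = fun s =>
      2 * A * congaRate t x *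
        (congaKernel α t x s + congaKernel α t x s * |s - x / α| / √(x / t)) := by
    ext s; ring
  have hcont : Continuous fun s : ℝ => w (1 - s).toNNReal :=
    hw.continuous.comp (continuous_real_toNNReal.comp (by fun_prop))
  have hrate := congaRate_nonneg t x
  rw [smoothingError, intervalIntegral_smul_eq_integral_Ioi _ hw.zero]
  refine (norm_integral_smul_sub_le_integral_mul
    (ψ := fun s => 2 * A * congaRate t x * (1 + |s - x / α| / √(x / t)))
    ?_ hk (integral_congaKernel hα₀ hσ hx0) hcont.aestronglyMeasurable ?_ ?_).trans ?_
  · filter_upwards [ae_restrict_mem measurableSet_Ioi] with s hs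
    exact congaKernel_nonneg hα₀.le hx0.le (le_of_lt hs)
  · filter_upwards [ae_restrict_mem measurableSet_Ioi] with s hs
    exact hw.norm_sub_le_congaRate hA ht hx0 (hx.2.trans hα₁.le) hα₀ hs
  · rw [hψ]
    exact (hk.add (hkabs.div_const _)).const_mul _
  · rw [hψ, integral_const_mul, integral_add hk (hkabs.div_const _), integral_div,
      integral_congaKernel hα₀ hσ hx0, mul_right_comm _ (1 + 2 / α)]
    exact mul_le_mul_of_nonneg_left (add_le_add_right hmean 1) (by positivity)

end SmoothingError

section Main

variable {Ω : Type*} [MeasurableSpace Ω] {P : Measure Ω} {E : Type*} [NormedAddCommGroup E]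
  [NormedSpace ℝ E] [CompleteSpace E] {X : ℝ≥0 → Ω → E} {K c : ℝ≥0} {α t : ℝ}

/-- The constant in front of the error scale, for a process whose increments over time `h` have
sub-Gaussian tails `exp (-ε ^ 2 / (c h))`. -/
noncomputable def congaConst (α c : ℝ) : ℝ := 2 * (38 * √(2 * c)) * (1 + 2 / α)

theorem IsSubgaussianProcess.measure_exists_lt_smoothingError_le (hX : IsSubgaussianProcess X K c P)
    (hc : 0 < c) (hα₀ : 0 < α) (hα₁ : α < 1) (ht : Real.exp 1 ≤ t) (htK : 2 * K ≤ t) {S : Set ℝ}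
    (hS : S ⊆ Set.Icc (1 / t) α) :
    P {ω | ∃ x ∈ S, congaConst α c * congaRate t x < smoothingError α t (X · ω) x} ≤
      ENNReal.ofReal (t ^ (-2 : ℝ)) := by
  refine (measure_mono ?_).trans (hX.measure_not_isRegularPath_le hc ht htK)
  rintro ω ⟨x, hx, hlt⟩ hreg
  exact hlt.not_ge (hreg.smoothingError_le (by positivity) hα₀ hα₁ ht (hS hx))

theorem IsSubgaussianProcess.ae_eventually_smoothingError_le (hX : IsSubgaussianProcess X K c P)
    (hc : 0 < c) (hα₀ : 0 < α) (hα₁ : α < 1) {S : ℝ → Set ℝ}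
    (hS : ∀ᶠ t in Filter.atTop, S t ⊆ Set.Icc (1 / t) α) :
    ∀ᵐ ω ∂P, ∀ᶠ t in Filter.atTop, ∀ x ∈ S t,
      smoothingError α t (X · ω) x ≤ congaConst α c * congaRate t x := by
  filter_upwards [hX.ae_eventually_isRegularPath hc] with ω hω
  filter_upwards [hω, hS, Filter.eventually_ge_atTop (Real.exp 1)] with t hreg hSt ht x hx
  exact hreg.smoothingError_le (by positivity) hα₀ hα₁ ht (hSt hx)

theorem exists_pos_forall_ge_of_eventually_atTop {p : ℝ → Prop} (h : ∀ᶠ t in Filter.atTop, p t) :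
    ∃ T : ℝ, 0 < T ∧ ∀ t : ℝ, T ≤ t → p t := by
  obtain ⟨T, hT⟩ := Filter.eventually_atTop.1 h
  exact ⟨max T 1, by positivity, fun t ht => hT t ((le_max_left _ _).trans ht)⟩

end Main

theorem mainTheorem6_general {E : Type*} [NormedAddCommGroup E] [NormedSpace ℝ E] [CompleteSpace E]
    (α : ℝ) (hα₀ : 0 < α) (hα₁ : α < 1) (K c : ℝ≥0) (hc : 0 < c) :
    ∃ κ : ℝ, 0 < κ ∧ ∃ t₀ : ℝ,
      ∀ (Ω : Type u) [MeasurableSpace Ω] (P : Measure Ω) (X : ℝ≥0 → Ω → E),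
        IsSubgaussianProcess X K c P →
        (∀ M : ℝ, 0 < M → ∀ᵐ ω ∂P, ∃ T : ℝ, 0 < T ∧ ∀ t : ℝ, T ≤ t →
          ∀ x ∈ congaAdmissible α M t,
            smoothingError α t (fun s => X s ω) x ≤ κ * congaRate t x) ∧
        (∀ β ≤ (1 : ℝ), ∀ᵐ ω ∂P, ∃ T : ℝ, 0 < T ∧ ∀ t : ℝ, T ≤ t →
          ∀ x ∈ Set.Icc (t ^ (-β)) α,
            smoothingError α t (fun s => X s ω) x ≤ κ * congaRate t x) ∧
        (∀ β ≤ (1 : ℝ), ∀ t : ℝ, t₀ ≤ t →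
          P {ω | ∃ x ∈ Set.Icc (t ^ (-β)) α,
            κ * congaRate t x < smoothingError α t (fun s => X s ω) x} ≤
              ENNReal.ofReal (t ^ (-2 : ℝ))) ∧
        (∀ M : ℝ, 0 < M → ∀ᵐ ω ∂P, ∃ T : ℝ, 0 < T ∧ ∀ t : ℝ, T ≤ t →
          ∀ x ∈ congaAdmissible α M t,
            smoothingError α t (fun s => X s ω) x ≤
              κ * (t ^ (-(1 / 4) : ℝ) * √(Real.log t))) := by
  have hκ : 0 < congaConst α c := by unfold congaConst; positivity
  refine ⟨congaConst α c, hκ, max (Real.exp 1) (2 * K), fun Ω _ P X hX => ⟨fun M hM => ?_,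
    fun β hβ => ?_, fun β hβ t ht => ?_, fun M hM => ?_⟩⟩
  · filter_upwards [hX.ae_eventually_smoothingError_le hc hα₀ hα₁
      (eventually_congaAdmissible_subset_Icc hα₀ hα₁ hM)] with ω hω
    exact exists_pos_forall_ge_of_eventually_atTop hω
  · filter_upwards [hX.ae_eventually_smoothingError_le hc hα₀ hα₁
      ((Filter.eventually_ge_atTop 1).mono fun _ => Icc_rpow_neg_subset_Icc hβ)] with ω hω
    exact exists_pos_forall_ge_of_eventually_atTop hω
  · obtain ⟨hte, htK⟩ := max_le_iff.1 ht
    exact hX.measure_exists_lt_smoothingError_le hc hα₀ hα₁ hte htK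
      (Icc_rpow_neg_subset_Icc hβ ((Real.one_le_exp zero_le_one).trans hte))
  · filter_upwards [hX.ae_eventually_smoothingError_le hc hα₀ hα₁
      (eventually_congaAdmissible_subset_Icc hα₀ hα₁ hM)] with ω hω
    refine exists_pos_forall_ge_of_eventually_atTop ?_
    filter_upwards [hω, Filter.eventually_ge_atTop (Real.exp 2)] with t hle ht x hx
    exact (hle x hx).trans (mul_le_mul_of_nonneg_left
      (congaRate_le ht hx.1.1 (hx.1.2.trans hα₁.le)) hκ.le)

theorem mainTheorem6 (α : ℝ) (hα₀ : 0 < α) (hα₁ : α < 1) :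
    ∃ κ : ℝ, 0 < κ ∧ ∃ t₀ : ℝ → ℝ,
      ∀ (Ω : Type u) [MeasurableSpace Ω] (P : Measure Ω) [IsProbabilityMeasure P]
        (W : ℝ≥0 → Ω → EuclideanSpace ℝ (Fin 2)), IsPlanarBrownian W P →
        (∀ M : ℝ, 0 < M → ∀ᵐ ω ∂P, ∃ T : ℝ, 0 < T ∧ ∀ t : ℝ, T ≤ t →
          ∀ x ∈ congaAdmissible α M t,
            congaError α t (fun s => W s ω) x ≤ κ * congaRate t x) ∧
        (∀ β ∈ Set.Ioo (0 : ℝ) 1, ∀ᵐ ω ∂P, ∃ T : ℝ, 0 < T ∧ ∀ t : ℝ, T ≤ t →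
          ∀ x ∈ Set.Icc (t ^ (-β)) α,
            congaError α t (fun s => W s ω) x ≤ κ * congaRate t x) ∧
        (∀ β ∈ Set.Ioo (0 : ℝ) 1, ∀ t : ℝ, t₀ β ≤ t →
          P {ω | ∃ x ∈ Set.Icc (t ^ (-β)) α,
            κ * congaRate t x < congaError α t (fun s => W s ω) x} ≤
              ENNReal.ofReal (t ^ (-2 : ℝ))) ∧
        (∀ M : ℝ, 0 < M → ∀ᵐ ω ∂P, ∃ T : ℝ, 0 < T ∧ ∀ t : ℝ, T ≤ t →
          ∀ x ∈ congaAdmissible α M t,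
            congaError α t (fun s => W s ω) x ≤
              κ * (t ^ (-(1 / 4) : ℝ) * √(Real.log t))) := by
  have hc : 0 < (2 * Fintype.card (Fin 2) : ℝ≥0) := by positivity
  obtain ⟨κ, hκ, t₀, h⟩ := mainTheorem6_general.{u} (E := EuclideanSpace ℝ (Fin 2)) α hα₀ hα₁
    (2 * Fintype.card (Fin 2)) _ hc
  refine ⟨κ, hκ, fun _ => t₀, fun Ω _ P _ W hW => ?_⟩
  obtain ⟨hadm, hIcc, hprob, hlog⟩ := h Ω P W (isSubgaussianProcess_of_isBrownianReal hW.coord)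
  exact ⟨hadm, fun β hβ => hIcc β hβ.2.le, fun β hβ => hprob β hβ.2.le, hlog⟩
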